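/- Definitions. Let $X$ be a metric space, $\mathcal C(X)$ the set of its closed subsets, $B(x,r)$ the closed ball. An *abstract pattern space over $X$* is a non-empty set $\Pi$ with a map $\Pi\times\mathcal C(X)\to\Pi$, $(\mathcal P,C)\mapsto\mathcal P\wedge C$, such that $(\mathcal P\wedge C_1)\wedge C_2=\mathcal P\wedge(C_1\cap C_2)$, and such that for each $\mathcal P\in\Pi$ there is a (necessarily unique) closed set $\operatorname{supp}\mathcal P$ with $\mathcal P\wedge C=\mathcal P\iff C\supset\operatorname{supp}\mathcal P$ for all $C\in\mathcal C(X)$. Its elements are called *abstract patterns*. Write $\mathcal P\geqq\mathcal Q$ if $\mathcal P\wedge\operatorname{supp}\mathcal Q=\mathcal Q$; this is a partial order, and $\bigvee$ denotes the supremum for it. A subset $\Xi\subset\Pi$ is *pairwise compatible* if any two elements of $\Xi$ have a common upper bound in $\Pi$, and *locally finite* if $\Xi\wedge B(x,r)=\{\mathcal P\wedge B(x,r):\mathcal P\in\Xi\}$ is finite for all $x\in X$, $r>0$. $\Pi$ is *glueable* if for every locally finite, pairwise compatible $\Xi\subset\Pi$ the supremum $\bigvee\Xi$ exists and $\bigvee\{\mathcal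 P\wedge C:\mathcal P\in\Xi\}=(\bigvee\Xi)\wedge C$ for all $C\in\mathcal C(X)$. An abstract pattern $\mathcal P$ *consists of bounded components* if there is $R>0$ such that $x\in\operatorname{supp}(\mathcal P\wedge C)$ implies $x\in\operatorname{supp}(\mathcal P\wedge C\wedge B(x,R))$, for all $C\in\mathcal C(X)$ and $x\in X$. If a group $\Gamma$ acts on $X$ by isometries, an *abstract pattern space over $(X,\Gamma)$* is an abstract pattern space $\Pi$ over $X$ with an action of $\Gamma$ on $\Pi$ such that $(\gamma\mathcal P)\wedge(\gamma C)=\gamma(\mathcal P\wedge C)$. For abstract patterns $\mathcal P$ and $\mathcal Q$ in (possibly different) abstract pattern spaces over $(X,\Gamma)$, $\mathcal Q$ is *locally derivable* from $\mathcal P$, written $\mathcal P\overset{\mathrm{LD}}{\rightarrow}\mathcal Q$, if there are $x_0,y_0\in X$ and $R_0\ge 0$ such that for all $\gamma,\eta\in\Gamma$ and $R\ge 0$, $(\gamma\mathcal P)\wedge B(x_0,R+R_0)=(\eta\mathcal P)\wedge B(x_0,R+R_0)$ implies $(\gamma\mathcal Q)\wedge B(y_0,R)=(\eta\mathcal Q)\wedge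 B(y_0,R)$. $\mathcal P$ and $\mathcal Q$ are *mutually locally derivable* (MLD) if $\mathcal P\overset{\mathrm{LD}}{\rightarrow}\mathcal Q$ and $\mathcal Q\overset{\mathrm{LD}}{\rightarrow}\mathcal P$. $\mathcal P$ is *Delone-deriving* if $\mathcal P\overset{\mathrm{LD}}{\rightarrow}D$ for some Delone set $D\subset X$, where subsets of $X$ form an abstract pattern space over $(X,\Gamma)$ with $D\wedge C=D\cap C$ and $\gamma D=\{\gamma x:x\in D\}$. Theorem. Let $d,m\ge 1$ and let $\Gamma$ be a closed subgroup of the group $\mathrm E(d)$ of all isometries of $\mathbb R^d$ (with the Euclidean metric) that contains all translations. Let $\Gamma_0$ be the stabilizer of the origin in $\Gamma$, let $\pi:\Gamma\to\Gamma_0$ send an isometry to its linear part, and let $\phi:\Gamma_0\to GL_m(\mathbb C)$ be a group homomorphism. Assume that there is $v\in\mathbb C^m\setminus\{0\}$ with $\phi(\gamma)v=v$ for all $\gamma\in\Gamma_0$, or that $\Gamma_0$ is finite. View the maps $f:\mathbb R^d\to\mathbb C^m$ as an abstract pattern space over $(\mathbb R^d,\Gamma)$, where $f\wedge C$ equals $f$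 on $C$ and $0$ off $C$, and $(\gamma f)(x)=\phi(\pi(\gamma))f(\gamma^{-1}x)$. Let $\Sigma$ be the set of the smooth ones among these maps and, for an abstract pattern $\mathcal P$ in an abstract pattern space over $(\mathbb R^d,\Gamma)$, let $\Sigma_{\mathcal P}=\{f\in\Sigma:\mathcal P\overset{\mathrm{LD}}{\rightarrow}f\}$ be the space of smooth $\mathcal P$-equivariant functions. Let $\Pi$ and $\Pi'$ be glueable abstract pattern spaces over $(\mathbb R^d,\Gamma)$, and let $\mathcal P\in\Pi$ and $\mathcal Q\in\Pi'$ be Delone-deriving and consist of bounded components. Then $\mathcal P$ and $\mathcal Q$ are MLD if and only if $\Sigma_{\mathcal P}=\Sigma_{\mathcal Q}$. -/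

import Mathlib

open TopologicalSpace
open scoped Pointwise ContDiff Matrix

noncomputable section

namespace AbstractPattern

/-! ### Abstract pattern spaces -/

/-- An abstract pattern space over a topological space `X`: a non-empty type `A` with a
cutting-off operation by closed subsets of `X`, such that cutting off twice is cutting off by the
intersection and every element has a support. -/
class PatternSpace (X : Type*) [TopologicalSpace X] (A : Type*) where
  nonempty : Nonempty A
  cut : A → Closeds X → A
  cut_cut : ∀ (P : A) (C₁ C₂ : Closeds X), cut (cut P C₁) C₂ = cut P (C₁ ⊓ C₂)
  exists_support : ∀ P : A, ∃ S : Closeds X, ∀ C : Closeds X, cut P C = P ↔ S ≤ C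

section Basic

variable (X : Type*) [TopologicalSpace X] {A : Type*} [PatternSpace X A]

/-- `cut X P C` is the abstract pattern `P ∧ C`. -/
def cut (P : A) (C : Closeds X) : A := PatternSpace.cut P C

/-- The support of an abstract pattern. -/
def supp (P : A) : Closeds X := (PatternSpace.exists_support (X := X) P).choose

/-- The support is characterized by `P ∧ C = P ↔ supp P ⊆ C`. -/
theorem cut_eq_self_iff (P : A) (C : Closeds X) : cut X P C = P ↔ supp X P ≤ C :=
  (PatternSpace.exists_support (X := X) P).choose_spec C

/-- The support is the only closed set with this property. -/
theorem eq_supp_of_forall (P : A) (S : Closeds X)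
    (h : ∀ C : Closeds X, cut X P C = P ↔ S ≤ C) : S = supp X P :=
  le_antisymm ((h _).1 ((cut_eq_self_iff X P _).2 le_rfl))
    ((cut_eq_self_iff X P _).1 ((h S).2 le_rfl))

/-- The relation `P ≧ Q`. -/
def Majorizes (P Q : A) : Prop := cut X P (supp X Q) = Q

/-- `S` is the supremum of `F` for the order `≧`. -/
def IsSupremum (F : Set A) (S : A) : Prop :=
  (∀ P ∈ F, Majorizes X S P) ∧ ∀ T : A, (∀ P ∈ F, Majorizes X T P) → Majorizes X T S

/-- `P` and `Q` have a common majorant in the ambient space. -/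
def Compatible (P Q : A) : Prop := ∃ T : A, Majorizes X T P ∧ Majorizes X T Q

/-- Any two elements of `F` are compatible. -/
def PairwiseCompatible (F : Set A) : Prop := ∀ P ∈ F, ∀ Q ∈ F, Compatible X P Q

/-- `cutSet X F C` is `F ∧ C = {P ∧ C | P ∈ F}`. -/
def cutSet (F : Set A) (C : Closeds X) : Set A := (fun P => cut X P C) '' F

end Basic

section Metric

/-- The closed ball `B(x, r)` as a closed set. -/
def cball {X : Type*} [MetricSpace X] (x : X) (r : ℝ) : Closeds X :=
  ⟨Metric.closedBall x r, Metric.isClosed_closedBall⟩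

variable (X : Type*) [MetricSpace X] {A : Type*} [PatternSpace X A]

/-- `F ∧ B(x, r)` is finite for all `x` and `r > 0`. -/
def LocallyFiniteSet (F : Set A) : Prop :=
  ∀ (x : X) (r : ℝ), 0 < r → (cutSet X F (cball x r)).Finite

/-- `P` consists of bounded components. -/
def BoundedComponents (P : A) : Prop :=
  ∃ R : ℝ, 0 < R ∧ ∀ (C : Closeds X), ∀ x ∈ supp X (cut X P C),
    x ∈ supp X (cut X (cut X P C) (cball x R))

/-- Locally finite, pairwise compatible sets have suprema, and taking suprema commutes with
cutting off. -/
def Glueable (A : Type*) [PatternSpace X A] : Prop :=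
  ∀ F : Set A, LocallyFiniteSet X F → PairwiseCompatible X F →
    ∃ S : A, IsSupremum X F S ∧ ∀ C : Closeds X, IsSupremum X (cutSet X F C) (cut X S C)

end Metric

/-! ### Group actions and local derivability -/

/-- The image `γ C` of a closed set under the action of `γ`. -/
def smulCloseds {Γ X : Type*} [Group Γ] [TopologicalSpace X] [MulAction Γ X]
    [ContinuousConstSMul Γ X] (γ : Γ) (C : Closeds X) : Closeds X :=
  ⟨γ • (C : Set X), C.isClosed.smul γ⟩

/-- `A`, with its action of `Γ`, is an abstract pattern space over `(X, Γ)`: the cutting-off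
operation is equivariant. -/
class EquivariantPatternSpace (Γ X : Type*) [Group Γ] [TopologicalSpace X] [MulAction Γ X]
    [ContinuousConstSMul Γ X] (A : Type*) [PatternSpace X A] [MulAction Γ A] : Prop where
  cut_smul : ∀ (γ : Γ) (P : A) (C : Closeds X), cut X (γ • P) (smulCloseds γ C) = γ • cut X P C

section LocalDerivability

variable (Γ : Type*) [Group Γ] (X Y : Type*) [MetricSpace X] [MetricSpace Y]
  {A B : Type*} [PatternSpace X A] [MulAction Γ A] [PatternSpace Y B] [MulAction Γ B]

/-- `P → Q`: the abstract pattern `Q`, over `(Y, Γ)`, is locally derivable from the abstract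
pattern `P`, over `(X, Γ)`. -/
def LocallyDerivable (P : A) (Q : B) : Prop :=
  ∃ (x₀ : X) (y₀ : Y) (R₀ : ℝ), 0 ≤ R₀ ∧ ∀ (γ η : Γ) (R : ℝ), 0 ≤ R →
    cut X (γ • P) (cball x₀ (R + R₀)) = cut X (η • P) (cball x₀ (R + R₀)) →
    cut Y (γ • Q) (cball y₀ R) = cut Y (η • Q) (cball y₀ R)

/-- `P` and `Q` are mutually locally derivable. -/
def MLD (P : A) (Q : B) : Prop := LocallyDerivable Γ X Y P Q ∧ LocallyDerivable Γ Y X Q P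

/-- For a set `S` of abstract patterns over `(Y, Γ)`, the set `S_P` of those elements of `S` that
are locally derivable from `P`. -/
def derivableIn (S : Set B) (P : A) : Set B := {Q ∈ S | LocallyDerivable Γ X Y P Q}

end LocalDerivability

/-! ### The space of all subsets, and Delone-deriving patterns -/

/-- All subsets of `X`, cut off by intersection. -/
instance instPatternSpaceSet (X : Type*) [TopologicalSpace X] : PatternSpace X (Set X) where
  nonempty := ⟨∅⟩
  cut D C := D ∩ C
  cut_cut D C₁ C₂ := by simp [Set.inter_assoc]
  exists_support D := ⟨Closeds.closure D, fun C => by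
    rw [Closeds.closure_le, Set.inter_eq_left]⟩

instance instEquivariantSet (Γ X : Type*) [Group Γ] [TopologicalSpace X] [MulAction Γ X]
    [ContinuousConstSMul Γ X] : EquivariantPatternSpace Γ X (Set X) where
  cut_smul _ _ _ := Set.smul_set_inter.symm

/-- Some Delone set in `X`, viewed as an abstract pattern in the space of subsets of `X`, is
locally derivable from `P`. -/
def DeloneDeriving (Γ X : Type*) [Group Γ] [MetricSpace X] [MulAction Γ X]
    {A : Type*} [PatternSpace X A] [MulAction Γ A] (P : A) : Prop :=
  ∃ D : Delone.DeloneSet X, LocallyDerivable Γ X X P (D : Set X)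

/-! ### The space of vector-valued maps with twisted action -/

/-- The space of all maps from `X` to `V`, where `ρ` is a linear action of `Γ` on `V`. -/
@[ext]
structure TwistedMap {Γ V : Type*} [Group Γ] [AddCommGroup V] [Module ℂ V]
    (X : Type*) (ρ : Γ →* Module.End ℂ V) where
  toFun : X → V

section TwistedMap

variable {Γ V : Type*} [Group Γ] [AddCommGroup V] [Module ℂ V] {X : Type*}
  (ρ : Γ →* Module.End ℂ V)

open Classical in
/-- `f ∧ C` equals `f` on `C` and `0` off `C`. -/
instance instPatternSpaceTwistedMap [TopologicalSpace X] : PatternSpace X (TwistedMap X ρ) where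
  nonempty := ⟨⟨0⟩⟩
  cut f C := ⟨fun x => if x ∈ C then f.toFun x else 0⟩
  cut_cut f C₁ C₂ := by
    ext x
    by_cases h₁ : x ∈ C₁ <;> by_cases h₂ : x ∈ C₂ <;>
      simp [← SetLike.mem_coe] at h₁ h₂ ⊢ <;> simp [h₁, h₂]
  exists_support f := ⟨Closeds.closure (Function.support f.toFun), fun C => by
    rw [Closeds.closure_le, TwistedMap.ext_iff, funext_iff]
    refine forall_congr' fun x => ?_
    by_cases h : x ∈ C
    · simp [h]
    · have h' : x ∉ (C : Set X) := h
      simp [h, eq_comm]⟩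

/-- `(γ f)(x) = ρ(γ) f(γ⁻¹ x)`. -/
instance instMulActionTwistedMap [MulAction Γ X] : MulAction Γ (TwistedMap X ρ) where
  smul γ f := ⟨fun x => ρ γ (f.toFun (γ⁻¹ • x))⟩
  one_smul f := by
    ext x
    change ρ 1 (f.toFun ((1 : Γ)⁻¹ • x)) = f.toFun x
    simp
  mul_smul γ η f := by
    ext x
    change ρ (γ * η) (f.toFun ((γ * η)⁻¹ • x)) = ρ γ (ρ η (f.toFun (η⁻¹ • γ⁻¹ • x)))
    simp [mul_smul]

instance instEquivariantTwistedMap [TopologicalSpace X] [MulAction Γ X]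
    [ContinuousConstSMul Γ X] : EquivariantPatternSpace Γ X (TwistedMap X ρ) where
  cut_smul γ f C := by
    classical
    ext x
    change (if x ∈ γ • (C : Set X) then ρ γ (f.toFun (γ⁻¹ • x)) else 0) =
      ρ γ (if γ⁻¹ • x ∈ (C : Set X) then f.toFun (γ⁻¹ • x) else 0)
    rw [Set.mem_smul_set_iff_inv_smul_mem]
    split_ifs <;> simp

end TwistedMap

/-! ### Groups of isometries of Euclidean space -/

/-- The Euclidean space `ℝ^d`. -/
abbrev E (d : ℕ) : Type := EuclideanSpace ℝ (Fin d)

/-- The group of all isometries of `ℝ^d`; every isometry of `ℝ^d` is affine. -/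
abbrev Motion (d : ℕ) : Type := E d ≃ᵃⁱ[ℝ] E d

/-- The linear part of an isometry, as a continuous linear operator on `ℝ^d`. -/
def linPart {d : ℕ} (g : Motion d) : E d →L[ℝ] E d :=
  (g.linearIsometryEquiv.toContinuousLinearEquiv : E d →L[ℝ] E d)

/-- The metric `ρ((a, A), (b, B)) = ‖a - b‖ + ‖A - B‖` (with the operator norm) on the group of
isometries, where `(a, A)` is the isometry `x ↦ A x + a`. -/
instance instMetricSpaceMotion (d : ℕ) : MetricSpace (Motion d) where
  dist g h := dist (g 0) (h 0) + ‖linPart g - linPart h‖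
  dist_self g := by simp
  dist_comm g h := by rw [dist_comm, norm_sub_rev]
  dist_triangle g h k := by
    have h₁ := dist_triangle (g 0) (h 0) (k 0)
    have h₂ := norm_sub_le_norm_sub_add_norm_sub (linPart g) (linPart h) (linPart k)
    linarith
  eq_of_dist_eq_zero {g h} H := by
    have H' : dist (g 0) (h 0) + ‖linPart g - linPart h‖ = 0 := H
    have h₁ : g 0 = h 0 := dist_eq_zero.1 <|
      le_antisymm (by linarith [norm_nonneg (linPart g - linPart h)]) dist_nonneg
    have h₂ : linPart g = linPart h := sub_eq_zero.1 <| norm_eq_zero.1 <|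
      le_antisymm (by linarith [dist_nonneg (x := g 0) (y := h 0)]) (norm_nonneg _)
    ext1 x
    have key : ∀ k : Motion d, k x = linPart k x + k 0 := fun k => by
      simpa [linPart] using k.map_vadd 0 x
    rw [key g, key h, h₁, h₂]

instance instMulActionMotion (d : ℕ) : MulAction (Motion d) (E d) where
  smul g x := g x
  one_smul _ := rfl
  mul_smul _ _ _ := rfl

instance instIsIsometricSMulMotion (d : ℕ) : IsIsometricSMul (Motion d) (E d) where
  isometry_smul g := g.isometry

instance instIsIsometricSMulSubgroup {d : ℕ} (Γ : Subgroup (Motion d)) :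
    IsIsometricSMul Γ (E d) where
  isometry_smul g := g.1.isometry

/-- `Γ` contains all translations of `ℝ^d`. -/
def ContainsTranslations {d : ℕ} (Γ : Subgroup (Motion d)) : Prop :=
  ∀ v : E d, AffineIsometryEquiv.constVAdd ℝ (E d) v ∈ Γ

/-- The isotropy group `Γ₀` of the origin. -/
abbrev isotropy {d : ℕ} (Γ : Subgroup (Motion d)) : Subgroup Γ :=
  MulAction.stabilizer Γ (0 : E d)

theorem linear_mem {d : ℕ} {Γ : Subgroup (Motion d)} (hΓ : ContainsTranslations Γ)
    {g : Motion d} (hg : g ∈ Γ) : g.linearIsometryEquiv.toAffineIsometryEquiv ∈ Γ := by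
  have h : g.linearIsometryEquiv.toAffineIsometryEquiv =
      AffineIsometryEquiv.constVAdd ℝ (E d) (-(g 0)) * g := by
    ext1 x
    have key : g x = g.linearIsometryEquiv x + g 0 := by simpa using g.map_vadd 0 x
    simp [key]
  rw [h]
  exact Γ.mul_mem (hΓ _) hg

/-- The projection `π : Γ → Γ₀`, `(a, A) ↦ A`. -/
def proj {d : ℕ} {Γ : Subgroup (Motion d)} (hΓ : ContainsTranslations Γ) : Γ →* isotropy Γ where
  toFun γ := ⟨⟨γ.1.linearIsometryEquiv.toAffineIsometryEquiv, linear_mem hΓ γ.2⟩,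
    map_zero γ.1.linearIsometryEquiv⟩
  map_one' := by
    refine Subtype.ext (Subtype.ext ?_)
    ext1 x
    rfl
  map_mul' γ η := by
    refine Subtype.ext (Subtype.ext ?_)
    ext1 x
    rfl

/-- The linear action on `ℂ^m` given by a group of invertible matrices. -/
def matrixAction {G : Type*} [Group G] {m : ℕ} (φ : G →* GL (Fin m) ℂ) :
    G →* Module.End ℂ (Fin m → ℂ) where
  toFun g := Matrix.toLin' (φ g : Matrix (Fin m) (Fin m) ℂ)
  map_one' := by simp [Module.End.one_eq_id]
  map_mul' g h := by simp [Matrix.toLin'_mul, Module.End.mul_eq_comp]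

/-- The space of all maps `ℝ^d → ℂ^m` with the action `(γ f)(x) = φ(π(γ)) f(γ⁻¹ x)`. -/
abbrev VectorMaps {d m : ℕ} {Γ : Subgroup (Motion d)} (hΓ : ContainsTranslations Γ)
    (φ : isotropy Γ →* GL (Fin m) ℂ) : Type :=
  TwistedMap (E d) ((matrixAction φ).comp (proj hΓ))

/-- The smooth maps `ℝ^d → ℂ^m`, as a subset of the space of all maps. -/
def smoothMaps {d m : ℕ} {Γ : Subgroup (Motion d)} (hΓ : ContainsTranslations Γ)
    (φ : isotropy Γ →* GL (Fin m) ℂ) : Set (VectorMaps hΓ φ) :=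
  {f | ContDiff ℝ ∞ f.toFun}

end AbstractPattern

end

open AbstractPattern

open AbstractPattern

namespace AbstractPattern


/-! ### Cutting off and gluing -/

section Cutting

variable {X : Type*} [TopologicalSpace X] {A : Type*} [PatternSpace X A]

/-! If `P` and `Q` are MLD, transitivity of local derivability gives equality of the two function
spaces. For the converse it suffices to find one smooth `f` that is MLD with `P` and one smooth `g`
that is MLD with `Q` (`exists_smooth_mld`): equality of the spaces then yields `Q → f → P` and `P →
g → Q`.

To build `f`, let `D` be a Delone set derived from `P`, and call two points equivalent if some `γ`
in `Γ` carries the patch of `P` of a large radius `R` at one to the patch at the other. Choose a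
representative `a` of each class in `D` and an injective label `code a`. The symmetries of the patch
at `a` form a finite set, since they permute the nearby points of `D` faithfully; hence some point
close to `a` is moved by every non-trivial one. A bump placed there is copied by all `γ` that match
the patch at `a`, and the copies are disjoint (`isSparse_deloneFrames`). The bump has an isolated
zero at its centre, and its germ there determines both the label and the group element that placed
it, even after a linear change of the values (`frameGerm_rigid`, `mem_of_isFrame`).

The bumps near a point depend only on `P` near it, so `P → f`. Conversely, if `δ f` and `f` agree on
a ball, the germs show that `δ P` and `P` agree on patches around the Delone points there; gluing
and bounded components turn this into agreement on the whole ball (`cut_eq_cut_of_cover`), so `f →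
P`. -/

theorem cut_cut (P : A) (C₁ C₂ : Closeds X) : cut X (cut X P C₁) C₂ = cut X P (C₁ ⊓ C₂) :=
  PatternSpace.cut_cut P C₁ C₂

theorem cut_supp (P : A) : cut X P (supp X P) = P :=
  (cut_eq_self_iff X P _).2 le_rfl

theorem supp_cut_le (P : A) (C : Closeds X) : supp X (cut X P C) ≤ C := by
  rw [← cut_eq_self_iff, cut_cut, inf_idem]

theorem cut_eq_cut_of_le {P Q : A} {C C' : Closeds X} (hC : C' ≤ C)
    (h : cut X P C = cut X Q C) : cut X P C' = cut X Q C' := by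
  have := congrArg (fun T => cut X T C') h
  simpa [cut_cut, inf_eq_right.2 hC] using this

theorem majorizes_cut (P : A) (C : Closeds X) : Majorizes X P (cut X P C) := by
  have h := cut_supp (X := X) (cut X P C)
  rwa [cut_cut, inf_eq_right.2 (supp_cut_le P C)] at h

theorem Majorizes.supp_le {P Q : A} (h : Majorizes X P Q) : supp X Q ≤ supp X P := by
  rw [← cut_eq_self_iff]
  conv_lhs => rw [← h, cut_cut, inf_comm, ← cut_cut, cut_supp]
  exact h

theorem Majorizes.antisymm {P Q : A} (h : Majorizes X P Q) (h' : Majorizes X Q P) : P = Q := by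
  have := le_antisymm h.supp_le h'.supp_le
  rw [← h, this, cut_supp]

theorem supp_cut_mono (P : A) {C C' : Closeds X} (h : C ≤ C') :
    supp X (cut X P C) ≤ supp X (cut X P C') := by
  have := majorizes_cut (cut X P C') C
  rw [cut_cut, inf_eq_right.2 h] at this
  exact this.supp_le

end Cutting

/-! ### Recovering a pattern from its patches -/

section Gluing

variable {X : Type*} [MetricSpace X] {A : Type*} [PatternSpace X A]

/-- `R` witnesses that `P` consists of bounded components. -/
def HasComponentBound (X : Type*) [MetricSpace X] {A : Type*} [PatternSpace X A]
    (P : A) (R : ℝ) : Prop :=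
  ∀ (C : Closeds X), ∀ x ∈ supp X (cut X P C), x ∈ supp X (cut X (cut X P C) (cball x R))

theorem mem_cball {x y : X} {r : ℝ} : y ∈ cball x r ↔ dist y x ≤ r := Iff.rfl

theorem cball_le_cball {x y : X} {r s : ℝ} (h : r + dist x y ≤ s) : cball x r ≤ cball y s :=
  Metric.closedBall_subset_closedBall' h

theorem HasComponentBound.mono {P : A} {R S : ℝ} (h : HasComponentBound X P R) (hRS : R ≤ S) :
    HasComponentBound X P S := by
  intro C x hx
  exact supp_cut_mono _ (cball_le_cball (by simpa using hRS)) (h C x hx)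

/-- `P ∧ C` bounds all pieces, so it majorizes `S`, and only the supports need comparison. By
bounded components, a point `y` of the support already lies in the support of `P ∧ C ∧ B(y, R)`, and
this ball lies inside one of the balls of radius `r + R`. -/
theorem IsSupremum.eq_cut_of_cover (P : A) {R r : ℝ} (hP : HasComponentBound X P R)
    {N : Set X} {C : Closeds X} (hC : ∀ y ∈ C, ∃ x ∈ N, dist y x ≤ r) {S : A}
    (hS : IsSupremum X ((fun x => cut X P (C ⊓ cball x (r + R))) '' N) S) : S = cut X P C := by
  have hle : Majorizes X (cut X P C) S := by
    refine hS.2 _ ?_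
    rintro _ ⟨x, -, rfl⟩
    simpa only [cut_cut] using majorizes_cut (cut X P C) (cball x (r + R))
  refine (hle.antisymm ?_).symm
  have key : supp X (cut X P C) ≤ supp X S := by
    intro y hy
    obtain ⟨x, hx, hxy⟩ := hC y (supp_cut_le P C hy)
    have h := hP C y hy
    rw [cut_cut] at h
    have hb : C ⊓ cball y R ≤ C ⊓ cball x (r + R) :=
      inf_le_inf_left _ (cball_le_cball (by linarith))
    exact (hS.1 _ ⟨x, hx, rfl⟩).supp_le (supp_cut_mono P hb h)
  have h2 : S = cut X P C := by
    rw [← (cut_eq_self_iff X (cut X P C) (supp X S)).2 key]; exact hle.symm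
  rw [h2]
  exact cut_supp _

/-- Two patterns with bounded components which agree on finitely many large balls agree on each
closed set which is covered by the corresponding smaller balls. -/
theorem cut_eq_cut_of_cover (hA : Glueable X A) {P Q : A} {R r : ℝ}
    (hP : HasComponentBound X P R) (hQ : HasComponentBound X Q R)
    {N : Set X} (hN : N.Finite) {C : Closeds X} (hC : ∀ y ∈ C, ∃ x ∈ N, dist y x ≤ r)
    (h : ∀ x ∈ N, cut X P (cball x (r + R)) = cut X Q (cball x (r + R))) :
    cut X P C = cut X Q C := by
  have hF : (fun x => cut X P (C ⊓ cball x (r + R))) '' N =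
      (fun x => cut X Q (C ⊓ cball x (r + R))) '' N :=
    Set.image_congr fun x hx => cut_eq_cut_of_le inf_le_right (h x hx)
  -- The family is finite, hence locally finite, and `P` is a common upper bound of any two members.
  obtain ⟨S, hS, -⟩ := hA ((fun x => cut X P (C ⊓ cball x (r + R))) '' N)
    (fun _ _ _ => (hN.image _).image _) (by
      rintro _ ⟨x, -, rfl⟩ _ ⟨y, -, rfl⟩
      exact ⟨P, majorizes_cut _ _, majorizes_cut _ _⟩)
  rw [← IsSupremum.eq_cut_of_cover P hP hC hS]
  rw [hF] at hS
  exact IsSupremum.eq_cut_of_cover Q hQ hC hS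

end Gluing

/-! ### A normal form of local derivability -/

section Fixes

variable {Γ X : Type*} [Group Γ] [MetricSpace X] {A : Type*} [PatternSpace X A] [MulAction Γ A]

/-- `γ P` and `P` agree on `B(y, R)`. -/
def Fixes (γ : Γ) (P : A) (y : X) (R : ℝ) : Prop :=
  cut X (γ • P) (cball y R) = cut X P (cball y R)

theorem Fixes.mono {γ : Γ} {P : A} {x y : X} {r s : ℝ} (h : Fixes γ P y s)
    (hs : r + dist x y ≤ s) : Fixes γ P x r :=
  cut_eq_cut_of_le (cball_le_cball hs) h

theorem fixes_one (P : A) (y : X) (R : ℝ) : Fixes (1 : Γ) P y R := by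
  rw [Fixes, one_smul]

variable [MulAction Γ X] [IsIsometricSMul Γ X]

theorem smulCloseds_cball (γ : Γ) (x : X) (r : ℝ) :
    smulCloseds γ (cball x r) = cball (γ • x) r :=
  SetLike.coe_injective (Metric.smul_closedBall γ x r)

variable [EquivariantPatternSpace Γ X A]

theorem smul_cut_cball (γ : Γ) (P : A) (x : X) (r : ℝ) :
    γ • cut X P (cball x r) = cut X (γ • P) (cball (γ • x) r) := by
  rw [← EquivariantPatternSpace.cut_smul, smulCloseds_cball]

theorem cut_smul_eq_iff (τ : Γ) {P Q : A} {x : X} {r : ℝ} :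
    cut X (τ • P) (cball (τ • x) r) = cut X (τ • Q) (cball (τ • x) r) ↔
      cut X P (cball x r) = cut X Q (cball x r) := by
  rw [← smul_cut_cball, ← smul_cut_cball, smul_left_cancel_iff]

theorem Fixes.inv {γ : Γ} {P : A} {y : X} {R : ℝ} (h : Fixes γ P y R) :
    Fixes γ⁻¹ P (γ⁻¹ • y) R := by
  have := (cut_smul_eq_iff (γ⁻¹)).2 h
  rw [inv_smul_smul] at this
  exact this.symm

theorem Fixes.mul {γ η : Γ} {P : A} {y : X} {R : ℝ} (h : Fixes γ P (γ • y) R)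
    (h' : Fixes η P y R) : Fixes (γ * η) P (γ • y) R := by
  have := (cut_smul_eq_iff γ).2 h'
  rw [← mul_smul] at this
  exact this.trans h

variable {B : Type*} [PatternSpace X B] [MulAction Γ B] [EquivariantPatternSpace Γ X B]

/-- Equivariance allows `η` to be moved to the left side, and transitivity allows the base point to
be any `y`. The distance of the two base points is absorbed into `R₀`. -/
theorem locallyDerivable_iff [Nonempty X] [MulAction.IsPretransitive Γ X] {P : A} {Q : B} :
    LocallyDerivable Γ X X P Q ↔ ∃ R₀ : ℝ, 0 ≤ R₀ ∧ ∀ (γ : Γ) (y : X) (R : ℝ), 0 ≤ R →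
      Fixes γ P y (R + R₀) → Fixes γ Q y R := by
  constructor
  · rintro ⟨x₀, y₀, R₀, hR₀, H⟩
    refine ⟨R₀ + dist x₀ y₀, by positivity, fun γ y R hR h => ?_⟩
    obtain ⟨τ, rfl⟩ := MulAction.exists_smul_eq Γ y₀ y
    have h1 := (cut_smul_eq_iff τ⁻¹).2 h
    have h2 := (cut_smul_eq_iff τ (x := y₀) (r := R) (P := (τ⁻¹ * γ) • Q) (Q := τ⁻¹ • Q)).2
    rw [mul_smul, smul_inv_smul, smul_inv_smul] at h2
    refine h2 ?_
    rw [← mul_smul]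
    refine H _ _ R hR (cut_eq_cut_of_le (C := cball y₀ (R + (R₀ + dist x₀ y₀)))
      (cball_le_cball (by linarith)) ?_)
    rwa [inv_smul_smul, ← mul_smul] at h1
  · rintro ⟨R₀, hR₀, H⟩
    obtain ⟨x₀⟩ := ‹Nonempty X›
    refine ⟨x₀, x₀, R₀, hR₀, fun γ η R hR h => ?_⟩
    have h1 := (cut_smul_eq_iff η⁻¹).2 h
    rw [inv_smul_smul, ← mul_smul] at h1
    have h2 := (cut_smul_eq_iff η).2 (H _ _ R hR h1)
    rwa [smul_inv_smul, ← mul_smul, mul_inv_cancel_left] at h2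

theorem LocallyDerivable.trans [Nonempty X] [MulAction.IsPretransitive Γ X]
    {D : Type*} [PatternSpace X D] [MulAction Γ D] [EquivariantPatternSpace Γ X D]
    {P : A} {Q : B} {T : D} (h : LocallyDerivable Γ X X P Q) (h' : LocallyDerivable Γ X X Q T) :
    LocallyDerivable Γ X X P T := by
  rw [locallyDerivable_iff] at *
  obtain ⟨R₁, h₁, H₁⟩ := h
  obtain ⟨R₂, h₂, H₂⟩ := h'
  refine ⟨R₂ + R₁, by positivity, fun γ y R hR h => H₂ _ _ _ hR (H₁ _ _ _ (by positivity) ?_)⟩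
  rwa [add_assoc]

theorem supp_smul (γ : Γ) (P : A) : supp X (γ • P) = smulCloseds γ (supp X P) := by
  refine (eq_supp_of_forall X _ _ fun C => ?_).symm
  have hC : C = smulCloseds γ (smulCloseds γ⁻¹ C) :=
    SetLike.coe_injective (smul_inv_smul γ (C : Set X)).symm
  rw [hC, EquivariantPatternSpace.cut_smul, smul_left_cancel_iff, cut_eq_self_iff]
  exact Set.smul_set_subset_smul_set_iff.symm

theorem mem_supp_smul {γ : Γ} {P : A} {x : X} : x ∈ supp X (γ • P) ↔ γ⁻¹ • x ∈ supp X P := by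
  rw [supp_smul]
  exact Set.mem_smul_set_iff_inv_smul_mem

theorem HasComponentBound.smul {P : A} {R : ℝ} (h : HasComponentBound X P R) (γ : Γ) :
    HasComponentBound X (γ • P) R := by
  intro C x hx
  have hC : C = smulCloseds γ (smulCloseds γ⁻¹ C) :=
    SetLike.coe_injective (smul_inv_smul γ (C : Set X)).symm
  rw [hC, EquivariantPatternSpace.cut_smul] at hx ⊢
  have := h _ _ (mem_supp_smul.1 hx)
  rwa [← smul_inv_smul γ x, ← smul_cut_cball, mem_supp_smul, inv_smul_smul]

end Fixes


/-! ### Functions which determine a frame -/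

section Germ

open Filter Topology

variable {d : ℕ}

/-- A polynomial on `ℝ^d` which is not invariant under any non-trivial linear isometry. -/
noncomputable def framePoly (n : ℕ) (z : E d) : ℝ :=
  ∑ i : Fin d, z i ^ (2 * (i : ℕ) + 1) + n * ‖z‖ ^ 2

/-- A function with an isolated zero at the origin, whose germ determines `n` and, up to scaling,
the orthonormal frame at the origin. -/
noncomputable def frameGerm (n : ℕ) (z : E d) : ℝ := ‖z‖ ^ 2 * Real.exp (framePoly n z)

@[simp]
theorem frameGerm_zero (n : ℕ) : frameGerm n (0 : E d) = 0 := by simp [frameGerm]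

theorem frameGerm_pos (n : ℕ) {z : E d} (hz : z ≠ 0) : 0 < frameGerm n z := by
  have := norm_pos_iff.2 hz
  unfold frameGerm
  positivity

theorem frameGerm_eq_zero {n : ℕ} {z : E d} : frameGerm n z = 0 ↔ z = 0 :=
  ⟨fun h => by_contra fun hz => (frameGerm_pos n hz).ne' h, fun h => h ▸ frameGerm_zero n⟩

theorem contDiff_frameGerm (n : ℕ) : ContDiff ℝ ∞ (frameGerm n : E d → ℝ) := by
  have h : ContDiff ℝ ∞ (fun z : E d => ‖z‖ ^ 2) := contDiff_norm_sq ℝ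
  unfold frameGerm framePoly
  refine h.mul (ContDiff.exp (ContDiff.add (ContDiff.sum fun i _ => ContDiff.pow ?_ _)
    (contDiff_const.mul h)))
  exact (EuclideanSpace.proj (𝕜 := ℝ) i).contDiff

theorem framePoly_smul (n : ℕ) (t : ℝ) (z : E d) :
    framePoly n (t • z) = ∑ i : Fin d, t ^ (2 * (i : ℕ) + 1) * z i ^ (2 * (i : ℕ) + 1) +
      t ^ 2 * (n * ‖z‖ ^ 2) := by
  simp only [framePoly, PiLp.smul_apply, smul_eq_mul, mul_pow, norm_smul, Real.norm_eq_abs, sq_abs]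
  ring

/-- Both sides are polynomials in `t` that agree on an interval, so their coefficients agree. Each
coordinate has its own odd exponent, and odd powers are injective on the reals; exponent 2 carries
the label and exponent 0 absorbs `c`. -/
theorem eq_of_framePoly_sub_eq {n m : ℕ} {u v : E d} (hv : v ≠ 0) (huv : ‖u‖ = ‖v‖) (c : ℝ)
    (h : ∀ᶠ t in 𝓝[>] (0 : ℝ), c + framePoly n (t • u) = framePoly m (t • v)) :
    u = v ∧ n = m := by
  classical
  set p : Polynomial ℝ := Polynomial.C c +
    ∑ i : Fin d, Polynomial.monomial (2 * (i : ℕ) + 1)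
      (u i ^ (2 * (i : ℕ) + 1) - v i ^ (2 * (i : ℕ) + 1)) +
    Polynomial.monomial 2 (n * ‖u‖ ^ 2 - m * ‖v‖ ^ 2) with hp
  have hp0 : p = 0 := by
    refine Polynomial.eq_zero_of_infinite_isRoot _ ?_
    obtain ⟨ε, hε, hsub⟩ := mem_nhdsGT_iff_exists_Ioo_subset.1 h
    refine (Set.Ioo_infinite hε).mono fun t ht => ?_
    have := hsub ht
    simp only [Set.mem_ofPred_eq, framePoly_smul] at this
    simp only [hp, Set.mem_ofPred_eq, Polynomial.IsRoot.def, Polynomial.eval_add, Polynomial.eval_C,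
      Polynomial.eval_finsetSum, Polynomial.eval_monomial, sub_mul, Finset.sum_sub_distrib]
    simp only [mul_comm (t ^ _)] at this
    linarith
  constructor
  · ext j
    have h1 : p.coeff (2 * (j : ℕ) + 1) = 0 := by rw [hp0]; simp
    have h2 : ∀ i : Fin d, (2 * (i : ℕ) + 1 = 2 * (j : ℕ) + 1) ↔ i = j := fun i => by
      rw [Fin.ext_iff]; omega
    have h3 : ¬ 2 = 2 * (j : ℕ) + 1 := by omega
    simp only [hp, Polynomial.coeff_add, Polynomial.finsetSum_coeff, Polynomial.coeff_monomial,
      Polynomial.coeff_C, h2, h3] at h1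
    simp only [Nat.add_eq_zero_iff, one_ne_zero, and_false, if_false, Finset.sum_ite_eq',
      Finset.mem_univ, if_true, zero_add, add_zero] at h1
    exact (Odd.strictMono_pow ⟨_, rfl⟩).injective (sub_eq_zero.1 h1)
  · have h1 : p.coeff 2 = 0 := by rw [hp0]; simp
    have h2 : ∀ i : Fin d, ¬ 2 * (i : ℕ) + 1 = 2 := fun i => by omega
    simp only [hp, Polynomial.coeff_add, Polynomial.finsetSum_coeff, Polynomial.coeff_monomial,
      Polynomial.coeff_C, h2] at h1
    have hv' : ‖v‖ ^ 2 ≠ 0 := by simpa using hv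
    simp only [huv, OfNat.ofNat_ne_zero, if_false, Finset.sum_const_zero, if_true, zero_add,
      ← sub_mul, mul_eq_zero, hv', or_false, sub_eq_zero] at h1
    exact_mod_cast h1

/-- Along a ray the factor `‖z‖ ^ 2` cancels because `k` is an isometry. Then `c` is a quotient of
exponentials, hence positive, and logarithms turn it into an additive constant. -/
theorem frameGerm_rigid (hd : 0 < d) {n m : ℕ} (k : E d ≃ₗᵢ[ℝ] E d) (c : ℝ)
    (h : ∀ᶠ z in 𝓝 (0 : E d), frameGerm n (k z) * c = frameGerm m z) :
    (∀ v, k v = v) ∧ n = m := by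
  have key : ∀ v : E d, v ≠ 0 → k v = v ∧ n = m := fun v hv => by
    have hlim : Tendsto (fun t : ℝ => t • v) (𝓝[>] 0) (𝓝 0) := by
      have : Continuous fun t : ℝ => t • v := by fun_prop
      simpa using (this.tendsto 0).mono_left nhdsWithin_le_nhds
    have h1 : ∀ᶠ t in 𝓝[>] (0 : ℝ),
        Real.exp (framePoly n (t • k v)) * c = Real.exp (framePoly m (t • v)) := by
      filter_upwards [hlim.eventually h, self_mem_nhdsWithin] with t ht ht0
      have ht0 : 0 < t := ht0
      have hn : ‖t • v‖ ^ 2 ≠ 0 := by simp [ht0.ne', hv]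
      simp only [frameGerm, k.norm_map] at ht
      rw [map_smul, mul_assoc] at ht
      exact mul_left_cancel₀ hn ht
    have hc : 0 < c := by
      obtain ⟨t, ht⟩ := h1.exists
      exact (mul_pos_iff_of_pos_left (Real.exp_pos _)).1 (ht ▸ Real.exp_pos _)
    refine eq_of_framePoly_sub_eq hv (k.norm_map v) (Real.log c) (h1.mono fun t ht => ?_)
    have := congrArg Real.log ht
    rwa [Real.log_mul (Real.exp_ne_zero _) hc.ne', Real.log_exp, Real.log_exp, add_comm] at this
  have : Nonempty (Fin d) := ⟨⟨0, hd⟩⟩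
  obtain ⟨v₀, hv₀⟩ := exists_ne (0 : E d)
  refine ⟨fun v => ?_, (key v₀ hv₀).2⟩
  by_cases hv : v = 0
  · simp [hv]
  · exact (key v hv).1

end Germ

/-! ### Smooth maps assembled from frames -/

section Frames

open Filter Topology

variable {d m : ℕ} {Γ : Subgroup (Motion d)} (ρ : Γ →* Module.End ℂ (Fin m → ℂ))
  (w : Fin m → ℂ) (r : ℕ → ℝ)

theorem twisted_smul_apply {V X : Type*} {G : Type*} [Group G] [AddCommGroup V] [Module ℂ V]
    [MulAction G X] {σ : G →* Module.End ℂ V} (γ : G) (f : TwistedMap X σ) (x : X) :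
    (γ • f).toFun x = σ γ (f.toFun (γ⁻¹ • x)) := rfl

theorem map_injective_of_group {V : Type*} {G : Type*} [Group G] [AddCommGroup V] [Module ℂ V]
    (σ : G →* Module.End ℂ V) (γ : G) {u v : V} (h : σ γ u = σ γ v) : u = v := by
  have := congrArg (σ γ⁻¹) h
  rwa [← Module.End.mul_apply, ← Module.End.mul_apply, ← map_mul, inv_mul_cancel, map_one] at this

theorem fixes_twisted_iff {V X : Type*} {G : Type*} [Group G] [AddCommGroup V] [Module ℂ V]
    [MetricSpace X] [MulAction G X] {σ : G →* Module.End ℂ V} {γ : G} {f : TwistedMap X σ}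
    {y : X} {R : ℝ} :
    Fixes γ f y R ↔ ∀ x, dist x y ≤ R → (γ • f).toFun x = f.toFun x := by
  classical
  have hcut : ∀ (g : TwistedMap X σ) (x : X),
      (cut X g (cball y R)).toFun x = if x ∈ cball y R then g.toFun x else 0 := fun g x => by
    change (if x ∈ cball y R then g.toFun x else 0) = _
    congr
  rw [Fixes, TwistedMap.ext_iff, funext_iff]
  refine forall_congr' fun x => ?_
  rw [hcut, hcut]
  by_cases hx : x ∈ cball y R
  · simp [hx, mem_cball.1 hx]
  · simp [hx, show ¬ dist x y ≤ R from hx]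

/-- The vector-valued map `z ↦ frameGerm n z • w`. -/
noncomputable def germMap (n : ℕ) : TwistedMap (E d) ρ := ⟨fun z => ((frameGerm n z : ℝ) : ℂ) • w⟩

/-- A smooth bump function supported in the ball of radius `r` (or of radius one, if `r` is not
positive). -/
noncomputable def originBump (r : ℝ) : ContDiffBump (0 : E d) where
  rIn := (if 0 < r then r else 1) / 2
  rOut := if 0 < r then r else 1
  rIn_pos := by split_ifs <;> positivity
  rIn_lt_rOut := by split_ifs <;> linarith

/-- The map `germMap` cut off smoothly. -/
noncomputable def bumpMap (n : ℕ) : TwistedMap (E d) ρ :=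
  ⟨fun z => ((frameGerm n z * originBump (r n) z : ℝ) : ℂ) • w⟩

/-- The frame `j = (θ, n)` occurs in `f`. -/
def IsFrame (f : TwistedMap (E d) ρ) (j : Γ × ℕ) : Prop :=
  f.toFun =ᶠ[𝓝 (j.1 • (0 : E d))] (j.1 • germMap ρ w j.2).toFun

/-- The balls of radius `r n` around the origins of the frames `(θ, n)` in `F` are locally
separated. -/
def IsSparse (F : Set (Γ × ℕ)) : Prop :=
  ∀ y : E d, ∃ ε > 0, ∀ j ∈ F, ∀ k ∈ F, dist y (j.1 • (0 : E d)) < r j.2 + ε →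
    dist y (k.1 • (0 : E d)) < r k.2 + ε → j = k

open Classical in
/-- The sum of the translates of the maps `bumpMap` along a set of frames. -/
noncomputable def frameMap (F : Set (Γ × ℕ)) : TwistedMap (E d) ρ where
  toFun y := if h : ∃ j ∈ F, dist y (j.1 • (0 : E d)) < r j.2 then
    (h.choose.1 • bumpMap ρ w r h.choose.2).toFun y else 0

variable {ρ w r} {F : Set (Γ × ℕ)}

theorem frameMap_eq (hF : IsSparse r F) {j : Γ × ℕ} (hj : j ∈ F) {y : E d}
    (hy : dist y (j.1 • (0 : E d)) < r j.2) :
    (frameMap ρ w r F).toFun y = (j.1 • bumpMap ρ w r j.2).toFun y := by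
  have h : ∃ j ∈ F, dist y (j.1 • (0 : E d)) < r j.2 := ⟨j, hj, hy⟩
  obtain ⟨ε, hε, H⟩ := hF y
  have : h.choose = j := H _ h.choose_spec.1 _ hj (by linarith [h.choose_spec.2]) (by linarith)
  simp only [frameMap, dif_pos h]
  rw [this]

theorem frameMap_eq_zero {y : E d} (hy : ∀ j ∈ F, r j.2 ≤ dist y (j.1 • (0 : E d))) :
    (frameMap ρ w r F).toFun y = 0 := by
  have h : ¬ ∃ j ∈ F, dist y (j.1 • (0 : E d)) < r j.2 := by push Not; exact hy
  simp only [frameMap, dif_neg h]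

theorem dist_inv_smul_zero (θ : Γ) (y : E d) : dist (θ⁻¹ • y) 0 = dist y (θ • (0 : E d)) := by
  rw [← dist_smul θ, smul_inv_smul]

theorem bumpMap_eq_zero {θ : Γ} {n : ℕ} (hr : 0 < r n) {y : E d}
    (hy : r n ≤ dist y (θ • (0 : E d))) : (θ • bumpMap ρ w r n).toFun y = 0 := by
  rw [twisted_smul_apply]
  have : originBump (d := d) (r n) (θ⁻¹ • y) = 0 := by
    refine ContDiffBump.zero_of_le_dist _ ?_
    rw [dist_inv_smul_zero]
    simpa [originBump, hr] using hy
  simp [bumpMap, this]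

theorem bumpMap_eq_zero_iff (hw : w ≠ 0) {θ : Γ} {n : ℕ} (hr : 0 < r n) {y : E d}
    (hy : dist y (θ • (0 : E d)) < r n) (h : (θ • bumpMap ρ w r n).toFun y = 0) :
    y = θ • (0 : E d) := by
  rw [twisted_smul_apply, ← map_zero (ρ θ)] at h
  have h := map_injective_of_group ρ θ h
  have hb : 0 < originBump (d := d) (r n) (θ⁻¹ • y) := by
    refine ContDiffBump.pos_of_mem_ball _ ?_
    rw [Metric.mem_ball, dist_inv_smul_zero]
    simpa [originBump, hr] using hy
  simp only [bumpMap, smul_eq_zero, hw, or_false, Complex.ofReal_eq_zero, mul_eq_zero, hb.ne',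
    frameGerm_eq_zero] at h
  rw [← h, smul_inv_smul]

/-- The margin `ε` in sparseness leaves room for at most one bump to meet the `ε`-ball around `y`.
-/
theorem frameMap_local (hr : ∀ n, 0 < r n) (hF : IsSparse r F) (y : E d) :
    (∃ j ∈ F, (frameMap ρ w r F).toFun =ᶠ[𝓝 y] (j.1 • bumpMap ρ w r j.2).toFun) ∨
      (frameMap ρ w r F).toFun =ᶠ[𝓝 y] 0 := by
  obtain ⟨ε, hε, H⟩ := hF y
  have near : ∀ j : Γ × ℕ, ∀ x ∈ Metric.ball y ε, dist x (j.1 • (0 : E d)) < r j.2 →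
      dist y (j.1 • (0 : E d)) < r j.2 + ε := fun j x hx h => by
    have := dist_triangle y x (j.1 • (0 : E d))
    rw [Metric.mem_ball, dist_comm] at hx
    linarith
  by_cases h : ∃ j ∈ F, dist y (j.1 • (0 : E d)) < r j.2 + ε
  · obtain ⟨j, hj, hjy⟩ := h
    refine Or.inl ⟨j, hj, Filter.eventuallyEq_of_mem (Metric.ball_mem_nhds y hε) fun x hx => ?_⟩
    by_cases hx' : dist x (j.1 • (0 : E d)) < r j.2
    · exact frameMap_eq hF hj hx'
    · rw [bumpMap_eq_zero (hr _) (not_lt.1 hx')]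
      refine frameMap_eq_zero fun k hk => not_lt.1 fun hkx => hx' ?_
      rwa [H j hj k hk hjy (near k x hx hkx)]
  · push Not at h
    refine Or.inr (Filter.eventuallyEq_of_mem (Metric.ball_mem_nhds y hε) fun x hx => ?_)
    refine frameMap_eq_zero fun j hj => not_lt.1 fun hjx => ?_
    exact (h j hj).not_gt (near j x hx hjx)

theorem contDiff_smul_toFun {f : TwistedMap (E d) ρ} (hf : ContDiff ℝ ∞ f.toFun) (θ : Γ) :
    ContDiff ℝ ∞ (θ • f).toFun := by
  have h1 : ContDiff ℝ ∞ (fun y : E d => θ⁻¹ • y) :=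
    (θ⁻¹).1.toAffineIsometry.toContinuousAffineMap.contDiff
  have h2 : ContDiff ℝ ∞ (fun v : Fin m → ℂ => ρ θ v) :=
    ((ρ θ).restrictScalars ℝ).toContinuousLinearMap.contDiff
  exact h2.comp (hf.comp h1)

theorem contDiff_bumpMap (n : ℕ) : ContDiff ℝ ∞ (bumpMap (d := d) ρ w r n).toFun := by
  have h : ContDiff ℝ ∞ (fun z : E d => frameGerm n z * originBump (r n) z) :=
    (contDiff_frameGerm n).mul (originBump (r n)).contDiff
  exact (Complex.ofRealCLM.contDiff.comp h).smul contDiff_const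

theorem contDiff_frameMap (hr : ∀ n, 0 < r n) (hF : IsSparse r F) :
    ContDiff ℝ ∞ (frameMap ρ w r F).toFun := by
  rw [contDiff_iff_contDiffAt]
  intro y
  rcases frameMap_local (ρ := ρ) (w := w) hr hF y with ⟨j, -, h⟩ | h
  · exact (contDiff_smul_toFun (contDiff_bumpMap j.2) j.1).contDiffAt.congr_of_eventuallyEq h
  · exact contDiffAt_const.congr_of_eventuallyEq h

theorem smul_bumpMap_eventuallyEq (θ : Γ) (n : ℕ) :
    (θ • bumpMap ρ w r n).toFun =ᶠ[𝓝 (θ • (0 : E d))] (θ • germMap ρ w n).toFun := by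
  have h1 : Tendsto (fun y : E d => θ⁻¹ • y) (𝓝 (θ • (0 : E d))) (𝓝 0) := by
    have := (continuous_const_smul (θ⁻¹) : Continuous fun y : E d => θ⁻¹ • y).tendsto
      (θ • (0 : E d))
    rwa [inv_smul_smul] at this
  filter_upwards [h1.eventually (originBump (d := d) (r n)).eventuallyEq_one] with y hy
  simp only [twisted_smul_apply, bumpMap, germMap]
  rw [hy]
  simp

theorem isFrame_of_mem (hr : ∀ n, 0 < r n) (hF : IsSparse r F) {j : Γ × ℕ} (hj : j ∈ F) :
    IsFrame ρ w (frameMap ρ w r F) j := by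
  refine EventuallyEq.trans ?_ (smul_bumpMap_eventuallyEq (r := r) j.1 j.2)
  exact Filter.eventuallyEq_of_mem (Metric.ball_mem_nhds _ (hr j.2)) fun x hx =>
    frameMap_eq hF hj hx

theorem motion_smul_eq_linear {k : Motion d} (hk : k (0 : E d) = 0) (z : E d) :
    k z = k.linearIsometryEquiv z := by
  simpa [hk] using k.map_vadd 0 z

/-- In the coordinates of `η`, the germs differ by the linear isometry `θ⁻¹ * η` and by replacing
`w` with the constant vector `ρ (η⁻¹ * θ) w`. A coordinate where `w` does not vanish reduces this to
a scalar factor, which `frameGerm_rigid` tolerates. -/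
theorem eq_of_germMap_eventuallyEq (hd : 0 < d) (hw : w ≠ 0) {θ η : Γ} {n l : ℕ}
    (h0 : θ • (0 : E d) = η • (0 : E d))
    (h : (θ • germMap ρ w n).toFun =ᶠ[𝓝 (θ • (0 : E d))] (η • germMap ρ w l).toFun) :
    θ = η ∧ n = l := by
  obtain ⟨i, hi⟩ := Function.ne_iff.1 hw
  have hi : w i ≠ 0 := hi
  have hk0 : (θ⁻¹ * η).1 (0 : E d) = 0 := by
    change (θ⁻¹ * η) • (0 : E d) = 0
    rw [mul_smul, ← h0, inv_smul_smul]
  have hη : Tendsto (fun z : E d => η • z) (𝓝 0) (𝓝 (θ • (0 : E d))) := by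
    rw [h0]
    exact (continuous_const_smul η : Continuous fun y : E d => η • y).tendsto 0
  have key := frameGerm_rigid hd (n := n) (m := l) (θ⁻¹ * η).1.linearIsometryEquiv
    (ρ (η⁻¹ * θ) w i / w i).re (by
      filter_upwards [hη.eventually h] with z hz
      rw [← motion_smul_eq_linear hk0]
      rw [twisted_smul_apply, twisted_smul_apply, inv_smul_smul] at hz
      have hz := congrArg (ρ η⁻¹) hz
      rw [← Module.End.mul_apply, ← Module.End.mul_apply, ← map_mul, ← map_mul, inv_mul_cancel,
        map_one, Module.End.one_apply, ← mul_smul] at hz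
      change ρ (η⁻¹ * θ) ((frameGerm n ((θ⁻¹ * η) • z) : ℂ) • w) = (frameGerm l z : ℂ) • w at hz
      rw [map_smul] at hz
      have hz := congrFun hz i
      simp only [Pi.smul_apply, smul_eq_mul] at hz
      rw [← Complex.re_ofReal_mul, ← mul_div_assoc]
      change (((frameGerm n ((θ⁻¹ * η) • z) : ℝ) : ℂ) * _ / _).re = _
      rw [hz, mul_div_cancel_right₀ _ hi, Complex.ofReal_re])
  refine ⟨?_, key.2⟩
  refine inv_mul_eq_one.1 (Subtype.ext ?_)
  ext1 z
  rw [motion_smul_eq_linear hk0, key.1]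
  rfl

/-- Inside its ball the bump vanishes only at the centre. On the sphere or outside, moving radially
away from the centre stays among zeros, so no zero there is isolated. -/
theorem eq_smul_zero_of_isolated {f : E d → Fin m → ℂ} (hw : w ≠ 0) {c : E d}
    {θ : Γ} {n : ℕ} (hr : 0 < r n) (hf : f =ᶠ[𝓝 c] (θ • bumpMap ρ w r n).toFun)
    (hc : f c = 0) (h : ∀ᶠ y in 𝓝 c, f y = 0 → y = c) : c = θ • (0 : E d) := by
  have hc' := hf.eq_of_nhds.symm.trans hc
  rcases lt_or_ge (dist c (θ • (0 : E d))) (r n) with hlt | hge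
  · exact bumpMap_eq_zero_iff hw hr hlt hc'
  · exfalso
    set c₀ := θ • (0 : E d)
    have hlim : Tendsto (fun t : ℝ => c + t • (c - c₀)) (𝓝[>] 0) (𝓝 c) := by
      have : Continuous fun t : ℝ => c + t • (c - c₀) := by fun_prop
      simpa using (this.tendsto 0).mono_left nhdsWithin_le_nhds
    obtain ⟨t, ⟨h1, h2⟩, ht⟩ :=
      ((hlim.eventually (hf.and h)).and self_mem_nhdsWithin).exists
    have ht : 0 < t := ht
    have hdist : r n ≤ dist (c + t • (c - c₀)) c₀ := by
      have : c + t • (c - c₀) - c₀ = (1 + t) • (c - c₀) := by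
        rw [add_smul, one_smul, sub_add_eq_add_sub]
      rw [dist_eq_norm, this, norm_smul, Real.norm_of_nonneg (by positivity)]
      rw [dist_eq_norm] at hge
      nlinarith [norm_nonneg (c - c₀)]
    rw [bumpMap_eq_zero hr hdist] at h1
    have h3 : t • (c - c₀) = 0 := by simpa using h2 h1
    rw [smul_eq_zero, or_iff_right ht.ne'] at h3
    rw [dist_eq_norm, h3, norm_zero] at hge
    exact hge.not_gt hr

/-- The converse of `isFrame_of_mem`: the germ at a frame has an isolated zero, so its origin is the
centre of a bump, and rigidity of germs identifies the two frames. This is how `F` is read off from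
the function. -/
theorem mem_of_isFrame (hd : 0 < d) (hw : w ≠ 0) (hr : ∀ n, 0 < r n) (hF : IsSparse r F)
    {j : Γ × ℕ} (hj : IsFrame ρ w (frameMap ρ w r F) j) : j ∈ F := by
  set f := (frameMap ρ w r F).toFun with hfdef
  have hzero : ∀ y, (j.1 • germMap ρ w j.2).toFun y = 0 ↔ y = j.1 • (0 : E d) := fun y => by
    rw [twisted_smul_apply]
    constructor
    · intro h
      rw [← map_zero (ρ j.1)] at h
      have h := map_injective_of_group ρ _ h
      simp only [germMap, smul_eq_zero, hw, or_false, Complex.ofReal_eq_zero,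
        frameGerm_eq_zero] at h
      rw [← h, smul_inv_smul]
    · rintro rfl
      simp [germMap]
  have hj' : f =ᶠ[𝓝 (j.1 • (0 : E d))] (j.1 • germMap ρ w j.2).toFun := hj
  have hc : f (j.1 • (0 : E d)) = 0 := hj'.eq_of_nhds.trans ((hzero _).2 rfl)
  have hiso : ∀ᶠ y in 𝓝 (j.1 • (0 : E d)), f y = 0 → y = j.1 • (0 : E d) :=
    hj'.mono fun y hy h0 => (hzero y).1 (hy ▸ h0)
  rcases frameMap_local (ρ := ρ) (w := w) hr hF (j.1 • (0 : E d)) with ⟨k, hk, h⟩ | h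
  · have hck := eq_smul_zero_of_isolated hw (hr k.2) h hc hiso
    have h2 := smul_bumpMap_eventuallyEq (ρ := ρ) (w := w) (r := r) k.1 k.2
    rw [← hck] at h2
    obtain ⟨h3, h4⟩ := eq_of_germMap_eventuallyEq hd hw hck (hj'.symm.trans (h.trans h2))
    rwa [show j = k from Prod.ext h3 h4]
  · exfalso
    have : Nonempty (Fin d) := ⟨⟨0, hd⟩⟩
    have : ∀ᶠ y in 𝓝 (j.1 • (0 : E d)), y = j.1 • (0 : E d) :=
      (hiso.and h).mono fun y hy => hy.1 hy.2
    have h5 : ∀ᶠ y in 𝓝[≠] (j.1 • (0 : E d)), False := by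
      filter_upwards [this.filter_mono nhdsWithin_le_nhds, self_mem_nhdsWithin] with y h1 h2
      exact h2 h1
    exact h5.exists.elim fun _ h => h

theorem IsFrame.of_fixes {f : TwistedMap (E d) ρ} {j : Γ × ℕ} (hj : IsFrame ρ w f j) {δ : Γ}
    {y : E d} {R : ℝ} (h : Fixes δ f y R) (hy : dist (j.1 • (0 : E d)) y < R) :
    IsFrame ρ w f (δ⁻¹ * j.1, j.2) := by
  rw [fixes_twisted_iff] at h
  have h1 : (δ • f).toFun =ᶠ[𝓝 (j.1 • (0 : E d))] (j.1 • germMap ρ w j.2).toFun := by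
    refine EventuallyEq.trans ?_ hj
    exact Filter.eventuallyEq_of_mem (Metric.isOpen_ball.mem_nhds hy) fun x hx => h x (le_of_lt hx)
  have h2 : Tendsto (fun x : E d => δ • x) (𝓝 ((δ⁻¹ * j.1) • (0 : E d)))
      (𝓝 (j.1 • (0 : E d))) := by
    have := (continuous_const_smul δ : Continuous fun y : E d => δ • y).tendsto
      ((δ⁻¹ * j.1) • (0 : E d))
    rwa [mul_smul, smul_inv_smul] at this
  filter_upwards [h2.eventually h1] with x hx
  rw [mul_smul, twisted_smul_apply δ⁻¹, inv_inv, ← hx, twisted_smul_apply, inv_smul_smul,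
    ← Module.End.mul_apply, ← map_mul, inv_mul_cancel, map_one, Module.End.one_apply]

theorem smul_frameMap_eq (hF : IsSparse r F) {δ : Γ} {y : E d}
    (h₁ : ∀ j ∈ F, dist y (j.1 • (0 : E d)) < r j.2 → (δ⁻¹ * j.1, j.2) ∈ F)
    (h₂ : ∀ j ∈ F, dist y ((δ * j.1) • (0 : E d)) < r j.2 → (δ * j.1, j.2) ∈ F) :
    (δ • frameMap ρ w r F).toFun y = (frameMap ρ w r F).toFun y := by
  have hdist : ∀ θ : Γ, dist (δ⁻¹ • y) (θ • (0 : E d)) = dist y ((δ * θ) • (0 : E d)) := fun θ => by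
    rw [← dist_smul δ, smul_inv_smul, mul_smul]
  rw [twisted_smul_apply]
  by_cases h : ∃ j ∈ F, dist y (j.1 • (0 : E d)) < r j.2
  · obtain ⟨j, hj, hjy⟩ := h
    rw [frameMap_eq hF hj hjy, frameMap_eq hF (h₁ j hj hjy) (by
      rwa [hdist, mul_inv_cancel_left]), mul_smul, twisted_smul_apply δ⁻¹, inv_inv, smul_inv_smul,
      ← Module.End.mul_apply, ← map_mul, mul_inv_cancel, map_one, Module.End.one_apply]
  · push Not at h
    rw [frameMap_eq_zero h, frameMap_eq_zero, map_zero]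
    intro j hj
    rw [hdist]
    by_contra hlt
    exact hlt (h _ (h₂ j hj (not_le.1 hlt)))

end Frames


/-! ### Delone sets and finite stabilizers -/

section Delone

open Filter Topology

variable {d : ℕ}

theorem finite_delone_inter_closedBall (D : Delone.DeloneSet (E d)) (y : E d) (R : ℝ) :
    ((D : Set (E d)) ∩ Metric.closedBall y R).Finite := by
  obtain ⟨t, -, ht, hcov⟩ := (isCompact_closedBall y R).finite_cover_balls
    (e := (D.packingRadius / 2 : NNReal)) (by simpa using D.packingRadius_pos)
  refine (ht.biUnion (t := fun x => (D : Set (E d)) ∩ Metric.ball x (D.packingRadius / 2 : NNReal))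
    fun x _ => ?_).subset ?_
  · exact Set.Subsingleton.finite fun u hu v hv => D.eq_of_mem_ball le_rfl hu.1 hv.1 hu.2 hv.2
  · rintro u ⟨hu, hu'⟩
    obtain ⟨x, hx, hux⟩ := Set.mem_iUnion₂.1 (hcov hu')
    exact Set.mem_iUnion₂.2 ⟨x, hx, hu, hux⟩

theorem countable_delone (D : Delone.DeloneSet (E d)) : (D : Set (E d)).Countable := by
  have h : (D : Set (E d)) = ⋃ n : ℕ, (D : Set (E d)) ∩ Metric.closedBall 0 n := by
    rw [← Set.inter_iUnion, Metric.iUnion_closedBall_nat, Set.inter_univ]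
  rw [h]
  exact Set.countable_iUnion fun n => (finite_delone_inter_closedBall D 0 n).countable

/-- The vectors fixed by the linear part of an isometry. -/
noncomputable def fixedSpace (g : Motion d) : Submodule ℝ (E d) :=
  LinearMap.eqLocus (linPart g).toLinearMap LinearMap.id

theorem mem_fixedSpace {g : Motion d} {a : E d} (ha : g a = a) (v : E d) :
    v ∈ fixedSpace g ↔ g (a + v) = a + v := by
  have h : g (v +ᵥ a) = g.linearIsometryEquiv v +ᵥ g a := g.map_vadd a v
  rw [ha, vadd_eq_add, vadd_eq_add, add_comm] at h
  rw [h, add_comm a, add_left_inj]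
  exact Iff.rfl

theorem eq_one_of_fixedSpace_eq_top {g : Motion d} {a : E d} (ha : g a = a)
    (h : fixedSpace g = ⊤) : g = 1 := by
  ext1 x
  have : x - a ∈ fixedSpace g := h ▸ Submodule.mem_top
  rw [mem_fixedSpace ha] at this
  simpa using this

/-- The points of `D` near `a` affinely span the space. Otherwise a vector of length `ρ + 1`
orthogonal to the fixed directions leads to a point at distance more than the covering radius `ρ`
from `D`. The bound `2ρ + 1` is `(ρ + 1) + ρ`. -/
theorem eq_one_of_fixes_delone (D : Delone.DeloneSet (E d)) {g : Motion d} {a : E d}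
    (ha : a ∈ D) (h : ∀ x ∈ D, dist x a ≤ 2 * D.coveringRadius + 1 → g x = x) : g = 1 := by
  have hga : g a = a := h a ha (by simp; positivity)
  refine eq_one_of_fixedSpace_eq_top hga ?_
  by_contra hK
  rw [← Submodule.orthogonal_eq_bot_iff] at hK
  obtain ⟨e, he, he0⟩ := Submodule.exists_mem_ne_zero_of_ne_bot hK
  have hρ := D.coveringRadius.coe_nonneg
  set ρ : ℝ := (D.coveringRadius : ℝ)
  have hn : 0 < ‖e‖ := norm_pos_iff.2 he0
  set u : E d := ((ρ + 1) / ‖e‖) • e with hu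
  have hu' : ‖u‖ = ρ + 1 := by
    rw [hu, norm_smul, Real.norm_of_nonneg (by positivity), div_mul_cancel₀ _ hn.ne']
  have huK : u ∈ (fixedSpace g)ᗮ := Submodule.smul_mem _ _ he
  obtain ⟨x, hx, hxd⟩ := D.exists_dist_le_coveringRadius (a + u)
  have hxd : ‖a + u - x‖ ≤ ρ := by rwa [← dist_eq_norm]
  have hxa : dist x a ≤ 2 * ρ + 1 := by
    have h1 := norm_sub_le u (a + u - x)
    have h2 : u - (a + u - x) = x - a := by abel
    rw [h2] at h1
    rw [dist_eq_norm]
    linarith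
  have hxK : x - a ∈ fixedSpace g := by
    rw [mem_fixedSpace hga, add_sub_cancel]
    exact h x hx hxa
  have hin : inner ℝ u (x - a) = 0 := Submodule.inner_left_of_mem_orthogonal hxK huK
  have h3 : ‖u - (x - a)‖ ^ 2 = ‖u‖ ^ 2 + ‖x - a‖ ^ 2 := by
    rw [norm_sub_sq_real, hin]; ring
  have h4 : u - (x - a) = a + u - x := by abel
  rw [h4, hu'] at h3
  nlinarith [norm_nonneg (a + u - x), sq_nonneg ‖x - a‖]

/-- A finite group fixing `a` acts freely on the orbit of some point close to `a`. -/
theorem exists_free_point {Γ : Subgroup (Motion d)} {a : E d} {H : Set Γ} (hH : H.Finite)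
    (ha : ∀ h ∈ H, h • a = a) {δ : ℝ} (hδ : 0 < δ) :
    ∃ (c : E d) (r : ℝ), 0 < r ∧ r ≤ δ ∧ dist c a ≤ δ ∧
      ∀ h ∈ H, h ≠ 1 → 4 * r ≤ dist c (h • c) := by
  -- A real vector space is not a finite union of proper subspaces.
  obtain ⟨v, hv⟩ : ∃ v : E d, ∀ h ∈ H, h ≠ 1 → v ∉ fixedSpace h.1 := by
    by_contra! hcon
    have hfin : Finite {h : Γ // h ∈ H ∧ h ≠ 1} := (hH.subset fun h hh => hh.1).to_subtype
    obtain ⟨⟨h, hh, h1⟩, htop⟩ := Subspace.exists_eq_top_of_iUnion_eq_univ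
      (p := fun h : {h : Γ // h ∈ H ∧ h ≠ 1} => fixedSpace h.1.1) (by
        refine Set.eq_univ_of_forall fun v => ?_
        obtain ⟨h, hh, h1, hv⟩ := hcon v
        exact Set.mem_iUnion.2 ⟨⟨h, hh, h1⟩, hv⟩)
    exact h1 (Subtype.ext (eq_one_of_fixedSpace_eq_top (ha h hh) htop))
  set t : ℝ := δ / (‖v‖ + 1) with ht
  have ht0 : 0 < t := by positivity
  set c : E d := a + t • v with hc
  have hfree : ∀ h ∈ H, h ≠ 1 → 0 < dist c (h • c) := fun h hh h1 => by
    refine dist_pos.2 fun heq => hv h hh h1 ?_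
    have := (mem_fixedSpace (ha h hh) (t • v)).2 heq.symm
    exact (Submodule.smul_mem_iff _ ht0.ne').1 this
  have hev : ∀ᶠ r in 𝓝[>] (0 : ℝ), ∀ h ∈ H, h ≠ 1 → 4 * r ≤ dist c (h • c) := by
    rw [Filter.eventually_all_finite hH]
    intro h hh
    by_cases h1 : h = 1
    · simp [h1]
    · have hpos := hfree h hh h1
      filter_upwards [Ioo_mem_nhdsGT (show (0 : ℝ) < dist c (h • c) / 4 by positivity)] with r hr _
      linarith [hr.2]
  obtain ⟨r, hr, hr'⟩ := (hev.and (Ioo_mem_nhdsGT hδ)).exists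
  refine ⟨c, r, hr'.1, hr'.2.le, ?_, hr⟩
  rw [hc, dist_eq_norm, add_sub_cancel_left, norm_smul, Real.norm_of_nonneg ht0.le, ht,
    div_mul_eq_mul_div, div_le_iff₀ (by positivity)]
  nlinarith [norm_nonneg v]

theorem fixes_set_iff {Γ X : Type*} [Group Γ] [MetricSpace X] [MulAction Γ X] {γ : Γ} {S : Set X}
    {y : X} {R : ℝ} : Fixes γ S y R ↔ ∀ z, dist z y ≤ R → (γ⁻¹ • z ∈ S ↔ z ∈ S) := by
  have : Fixes γ S y R ↔
      (γ • S) ∩ Metric.closedBall y R = S ∩ Metric.closedBall y R := Iff.rfl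
  rw [this, Set.ext_iff]
  refine forall_congr' fun z => ?_
  simp only [Set.mem_inter_iff, Metric.mem_closedBall, Set.mem_smul_set_iff_inv_smul_mem]
  tauto

end Delone

/-! ### The universal smooth function -/

section Universal

variable {d : ℕ} {Γ : Subgroup (Motion d)} {A : Type*} [PatternSpace (E d) A] [MulAction Γ A]
  (P : A) (R : ℝ)

/-- `γ` moves the part of `P` around `x` to the part of `P` around `γ x`. -/
def Matches (γ : Γ) (x : E d) : Prop := Fixes γ P (γ • x) R

variable {P R}

theorem matches_one (x : E d) : Matches P R (1 : Γ) x := fixes_one _ _ _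

/-- Such elements map the finite set of points of `D` near `a` to itself, and by
`eq_one_of_fixes_delone` they are determined by this action. -/
theorem finite_matches_stabilizer (D : Delone.DeloneSet (E d)) {a : E d} (ha : a ∈ D)
    (hD : ∀ (γ : Γ) (x z : E d), Fixes γ P x R → dist z x ≤ 2 * D.coveringRadius + 1 →
      (γ⁻¹ • z ∈ D ↔ z ∈ D)) :
    {h : Γ | h • a = a ∧ Matches P R h a}.Finite := by
  set S := (D : Set (E d)) ∩ Metric.closedBall a (2 * D.coveringRadius + 1)
  have hS : Finite S := (finite_delone_inter_closedBall D a _).to_subtype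
  have hmap : ∀ h ∈ {h : Γ | h • a = a ∧ Matches P R h a}, ∀ x ∈ S, h • x ∈ S := by
    rintro h ⟨h1, h2⟩ x ⟨hx, hxa⟩
    have hd : dist (h • x) a ≤ 2 * D.coveringRadius + 1 := by
      conv_lhs => rw [← h1]
      rwa [dist_smul]
    refine ⟨?_, hd⟩
    rw [Matches, h1] at h2
    have := hD h a (h • x) h2 hd
    rw [inv_smul_smul] at this
    exact this.1 hx
  rw [← Set.finite_coe_iff]
  refine Finite.of_injective (β := S → S) (fun h x => ⟨h.1 • x.1, hmap h.1 h.2 x.1 x.2⟩) ?_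
  intro h k hhk
  have hfix : (h.1⁻¹ * k.1).1 = 1 := by
    refine eq_one_of_fixes_delone D ha fun x hx hxa => ?_
    have : h.1 • x = k.1 • x := congrArg Subtype.val (congrFun hhk ⟨x, hx, hxa⟩)
    change (h.1⁻¹ * k.1) • x = x
    rw [mul_smul, ← this, inv_smul_smul]
  exact Subtype.ext (inv_mul_eq_one.1 (Subtype.ext hfix))

variable [EquivariantPatternSpace Γ (E d) A]

theorem Matches.inv {γ : Γ} {x : E d} (h : Matches P R γ x) : Matches P R γ⁻¹ (γ • x) :=
  Fixes.inv h

theorem Matches.mul {γ η : Γ} {x : E d} (h : Matches P R γ (η • x)) (h' : Matches P R η x) :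
    Matches P R (γ * η) x := by
  have := Fixes.mul h h'
  rwa [← mul_smul] at this

variable (Γ P R)

/-- Two points are equivalent if some element of `Γ` matches them. -/
def matchSetoid : Setoid (E d) where
  r x y := ∃ γ : Γ, γ • x = y ∧ Matches P R γ x
  iseqv :=
    { refl := fun x => ⟨1, one_smul _ _, matches_one x⟩
      symm := by
        rintro x _ ⟨γ, rfl, h⟩
        exact ⟨γ⁻¹, inv_smul_smul _ _, h.inv⟩
      trans := by
        rintro x _ _ ⟨γ, rfl, h⟩ ⟨η, rfl, h'⟩
        exact ⟨η * γ, mul_smul _ _ _, h'.mul h⟩ }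

/-- A representative of the class of `x`. -/
noncomputable def matchRep (x : E d) : E d := (Quotient.mk (matchSetoid Γ P R) x).out

variable {Γ P R}

theorem exists_matches_matchRep (x : E d) :
    ∃ γ : Γ, γ • matchRep Γ P R x = x ∧ Matches P R γ (matchRep Γ P R x) :=
  Quotient.exact (s := matchSetoid Γ P R) (Quotient.out_eq (Quotient.mk (matchSetoid Γ P R) x))

theorem matchRep_smul {γ : Γ} {x : E d} (h : Matches P R γ x) :
    matchRep Γ P R (γ • x) = matchRep Γ P R x := by
  unfold matchRep
  rw [Quotient.sound (s := matchSetoid Γ P R) (a := x) (b := γ • x) ⟨γ, rfl, h⟩]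

theorem matchRep_idem (x : E d) : matchRep Γ P R (matchRep Γ P R x) = matchRep Γ P R x := by
  obtain ⟨γ, h, h'⟩ := exists_matches_matchRep (Γ := Γ) (P := P) (R := R) x
  have := matchRep_smul h'
  rw [h] at this
  exact this.symm

variable {m : ℕ}

theorem isPretransitive_of_translations (hΓ : ContainsTranslations Γ) :
    MulAction.IsPretransitive Γ (E d) :=
  ⟨fun x y => ⟨⟨AffineIsometryEquiv.constVAdd ℝ (E d) (y - x), hΓ _⟩, sub_add_cancel y x⟩⟩

variable (Γ P R) in
/-- The frames attached to the points of a Delone set: for a representative `a`, the origin of the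
attached frame is the origin of `τ a`, and `code a` is the label of the class of `a`. -/
def deloneFrames (D : Set (E d)) (τ : E d → Γ) (code : E d → ℕ) : Set (Γ × ℕ) :=
  {j | ∃ a ∈ D, matchRep Γ P R a = a ∧ ∃ γ : Γ, Matches P R γ a ∧ j = (γ * τ a, code a)}

/-- Frames that reach the same `y` belong to Delone points closer than the packing radius, hence to
a single point and a single representative. They then differ by a symmetry of the patch, and `hfree`
makes it trivial. -/
theorem isSparse_deloneFrames (D : Delone.DeloneSet (E d)) {τ : E d → Γ} {code : E d → ℕ}
    {r : ℕ → ℝ} (hr : ∀ n, 0 < r n)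
    (hD : ∀ (γ : Γ), ∀ x ∈ D, Matches P R γ x → γ • x ∈ D)
    (hτ : ∀ a ∈ D, dist (τ a • (0 : E d)) a ≤ D.packingRadius / 8)
    (hrs : ∀ a ∈ D, r (code a) ≤ D.packingRadius / 8)
    (hfree : ∀ a ∈ D, ∀ h : Γ, h • a = a → Matches P R h a → h ≠ 1 →
      4 * r (code a) ≤ dist (τ a • (0 : E d)) (h • τ a • (0 : E d))) :
    IsSparse r (deloneFrames Γ P R (D : Set (E d)) τ code) := by
  intro y
  have hs : (0 : ℝ) < D.packingRadius := by exact_mod_cast D.packingRadius_pos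
  set s : ℝ := (D.packingRadius : ℝ)
  have near : ∀ a ∈ D, ∀ γ : Γ, dist y ((γ * τ a) • (0 : E d)) < r (code a) + s / 8 →
      dist y (γ • a) < s / 2 := fun a ha γ h => by
    have h1 := dist_triangle y ((γ * τ a) • (0 : E d)) (γ • a)
    have h2 : dist ((γ * τ a) • (0 : E d)) (γ • a) ≤ s / 8 := by
      rw [mul_smul, dist_smul]; exact hτ a ha
    have := hrs a ha
    linarith
  by_cases hex : ∃ a ∈ D, matchRep Γ P R a = a ∧ ∃ γ : Γ, Matches P R γ a ∧
      dist y ((γ * τ a) • (0 : E d)) < r (code a) + s / 8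
  · obtain ⟨a₀, ha₀, hrep₀, γ₀, hm₀, hy₀⟩ := hex
    have same : ∀ a ∈ D, matchRep Γ P R a = a → ∀ γ : Γ, Matches P R γ a →
        dist y ((γ * τ a) • (0 : E d)) < r (code a) + s / 8 → γ • a = γ₀ • a₀ ∧ a = a₀ := by
      intro a ha hrep γ hm hy
      have h1 := near a ha γ hy
      have h2 := near a₀ ha₀ γ₀ hy₀
      have h3 : γ • a = γ₀ • a₀ := by
        by_contra hne
        have h4 := D.packingRadius_lt_dist_of_mem_ne (hD γ a ha hm) (hD γ₀ a₀ ha₀ hm₀) hne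
        have h5 := dist_triangle_left (γ • a) (γ₀ • a₀) y
        have h4 : s < dist (γ • a) (γ₀ • a₀) := h4
        linarith
      refine ⟨h3, ?_⟩
      rw [← hrep, ← hrep₀, ← matchRep_smul hm, ← matchRep_smul hm₀, h3]
    -- The bound `s / 8` identifies the Delone points; the bound `r (code a₀)` keeps the distance of
    -- two centres below `4 * r`, contradicting `hfree`.
    refine ⟨min (s / 8) (r (code a₀)), lt_min (by positivity) (hr _), ?_⟩
    rintro _ ⟨a, ha, hrep, γ, hm, rfl⟩ _ ⟨b, hb, hrepb, η, hmb, rfl⟩ hj hk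
    have hmin' := min_le_right (s / 8) (r (code a₀))
    obtain ⟨h1, rfl⟩ := same a ha hrep γ hm (hj.trans_le (by simp))
    obtain ⟨h2, rfl⟩ := same b hb hrepb η hmb (hk.trans_le (by simp))
    suffices γ = η by rw [this]
    by_contra hne
    have hfix : (γ⁻¹ * η) • b = b := by rw [mul_smul, h2, ← h1, inv_smul_smul]
    have hm' : Matches P R (γ⁻¹ * η) b := by
      refine Matches.mul ?_ hmb
      rw [h2, ← h1]
      exact hm.inv
    have h4 := hfree b ha _ hfix hm' fun h => hne (inv_mul_eq_one.1 h)
    have h5 := dist_triangle_left ((γ * τ b) • (0 : E d)) ((η * τ b) • (0 : E d)) y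
    have h6 : dist (τ b • (0 : E d)) ((γ⁻¹ * η) • τ b • (0 : E d)) =
        dist ((γ * τ b) • (0 : E d)) ((η * τ b) • (0 : E d)) := by
      rw [← dist_smul γ, ← mul_smul, ← mul_smul, ← mul_smul]
      congr 2
      group
    simp only at hj hk
    linarith
  · push Not at hex
    refine ⟨s / 8, by positivity, ?_⟩
    rintro _ ⟨a, ha, hrep, γ, hm, rfl⟩ _ - hj
    exact absurd hj (hex a ha hrep γ hm).not_gt

/-- From a glueable Delone-deriving pattern which consists of bounded components one obtains a
smooth function which is mutually locally derivable with it. The action on the values may be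
arbitrary: the patterns are encoded by germs of the function up to linear automorphisms. -/
theorem exists_smooth_mld (hd : 0 < d) (hΓ : ContainsTranslations Γ)
    (ρ : Γ →* Module.End ℂ (Fin m → ℂ)) {w : Fin m → ℂ} (hw : w ≠ 0)
    (hA : Glueable (E d) A) {P : A} (hPD : DeloneDeriving Γ (E d) P)
    (hPb : BoundedComponents (E d) P) :
    ∃ f : TwistedMap (E d) ρ, ContDiff ℝ ∞ f.toFun ∧ MLD Γ (E d) (E d) P f := by
  have := isPretransitive_of_translations hΓ
  obtain ⟨D, hD⟩ := hPD
  obtain ⟨Rb, -, hRb⟩ := hPb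
  have hRb : HasComponentBound (E d) P Rb := hRb
  obtain ⟨R₀, hR₀, hD⟩ := locallyDerivable_iff.1 hD
  have hs : (0 : ℝ) < D.packingRadius := by exact_mod_cast D.packingRadius_pos
  set s : ℝ := (D.packingRadius : ℝ) with hsdef
  have hcov := D.coveringRadius.coe_nonneg
  set κ : ℝ := (D.coveringRadius : ℝ) with hκ
  -- The first term leaves a component bound `R - κ` for a cover by balls of radius `κ`; the second
  -- makes a patch of `P` determine `D` within `2κ + 1`.
  set R : ℝ := max (Rb + κ) (2 * κ + 1 + R₀) with hR
  have hRb' : HasComponentBound (E d) P (R - κ) :=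
    hRb.mono (by linarith [le_max_left (Rb + κ) (2 * κ + 1 + R₀)])
  have hR0 : 0 ≤ R := by
    have := le_max_right (Rb + κ) (2 * κ + 1 + R₀)
    linarith
  have hDR : ∀ (γ : Γ) (x z : E d), Fixes γ P x R → dist z x ≤ 2 * D.coveringRadius + 1 →
      (γ⁻¹ • z ∈ D ↔ z ∈ D) := fun γ x z h hz =>
    fixes_set_iff.1 (hD γ x (2 * κ + 1) (by positivity)
      (h.mono (by simp [hR]))) z hz
  have hDm : ∀ γ : Γ, ∀ x, Matches P R γ x → (x ∈ D ↔ γ • x ∈ D) := fun γ x h => by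
    have := hDR γ (γ • x) (γ • x) h (by simp; positivity)
    rwa [inv_smul_smul] at this
  have hpoint : ∀ a : E d, ∃ (c : E d) (r : ℝ), 0 < r ∧ (a ∈ D → r ≤ s / 8 ∧ dist c a ≤ s / 8 ∧
      ∀ h : Γ, h • a = a → Matches P R h a → h ≠ 1 → 4 * r ≤ dist c (h • c)) := fun a => by
    by_cases ha : a ∈ D
    · obtain ⟨c, r, h1, h2, h3, h4⟩ := exists_free_point (finite_matches_stabilizer D ha hDR)
        (fun h hh => hh.1) (show 0 < s / 8 by positivity)
      exact ⟨c, r, h1, fun _ => ⟨h2, h3, fun h h5 h6 => h4 h ⟨h5, h6⟩⟩⟩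
    · exact ⟨0, 1, one_pos, fun h => absurd h ha⟩
  choose c rad hrad hc using hpoint
  obtain ⟨code, hcode⟩ := Set.countable_iff_exists_injOn.1 (countable_delone D)
  -- The radius must be a function of the label alone; injectivity of `code` on `D` makes this
  -- possible.
  set r : ℕ → ℝ := fun n => rad (Function.invFunOn code (D : Set (E d)) n)
  have hr : ∀ n, 0 < r n := fun n => hrad _
  have hrcode : ∀ a ∈ D, r (code a) = rad a := fun a ha =>
    congrArg rad (hcode.leftInvOn_invFunOn ha)
  set τ : E d → Γ := fun a => ⟨AffineIsometryEquiv.constVAdd ℝ (E d) (c a), hΓ _⟩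
  have hτ : ∀ a, τ a • (0 : E d) = c a := fun a => add_zero (c a)
  set F := deloneFrames Γ P R (D : Set (E d)) τ code with hFdef
  have hF : IsSparse r F := by
    refine isSparse_deloneFrames D hr (fun γ x hx h => (hDm γ x h).1 hx) ?_ ?_ ?_
    · intro a ha
      rw [hτ]
      exact (hc a ha).2.1
    · intro a ha
      rw [hrcode a ha]
      exact (hc a ha).1
    · intro a ha h h1 h2 h3
      rw [hrcode a ha, hτ]
      exact (hc a ha).2.2 h h1 h2 h3
  have hdist : ∀ a ∈ D, ∀ γ : Γ, dist (γ • a) ((γ * τ a) • (0 : E d)) ≤ s / 8 := fun a ha γ => by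
    rw [mul_smul, dist_smul, hτ, dist_comm]
    exact (hc a ha).2.1
  refine ⟨frameMap ρ w r F, contDiff_frameMap hr hF, ?_, ?_⟩
  -- A bump that reaches `x` belongs to a Delone point within `s / 8 + s / 8` of `x`, so `s` is
  -- ample.
  · refine locallyDerivable_iff.2 ⟨R + s, by positivity, fun δ y T hT h => ?_⟩
    have hfix : ∀ x z : E d, dist x y ≤ T → dist z x ≤ s → Fixes δ P z R := fun x z hx hz => by
      have := dist_triangle z x y
      exact h.mono (by linarith)
    rw [fixes_twisted_iff]
    intro x hx
    refine smul_frameMap_eq hF ?_ ?_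
    · rintro _ ⟨a, ha, hrep, γ, hm, rfl⟩ hxj
      refine ⟨a, ha, hrep, δ⁻¹ * γ, Matches.mul ?_ hm, by rw [mul_assoc]⟩
      refine (hfix x (γ • a) hx ?_).inv
      have h1 := hdist a ha γ
      have h2 := dist_triangle_right (γ • a) x ((γ * τ a) • (0 : E d))
      have h3 := (hc a ha).1
      rw [← hrcode a ha] at h3
      simp only at hxj
      linarith
    · rintro _ ⟨a, ha, hrep, γ, hm, rfl⟩ hxj
      refine ⟨a, ha, hrep, δ * γ, Matches.mul ?_ hm, by rw [mul_assoc]⟩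
      refine hfix x (δ • γ • a) hx ?_
      have h1 := hdist a ha (δ * γ)
      have h2 := dist_triangle_right ((δ * γ) • a) x ((δ * γ * τ a) • (0 : E d))
      have h3 := (hc a ha).1
      rw [← hrcode a ha] at h3
      simp only [← mul_assoc] at hxj
      rw [← mul_smul]
      linarith
  -- The ball `B(y, T)` is covered by `κ`-balls around Delone points in `B(y, T + κ)`, whose frames
  -- have origins at most `s / 8` further away.
  · refine locallyDerivable_iff.2 ⟨κ + s, by positivity, fun δ y T hT h => ?_⟩
    refine cut_eq_cut_of_cover hA (hRb'.smul δ) hRb' (r := κ)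
      (finite_delone_inter_closedBall D y (T + κ)) ?_ ?_
    · intro x hx
      obtain ⟨z, hz, hxz⟩ := D.exists_dist_le_coveringRadius x
      refine ⟨z, ⟨hz, ?_⟩, hxz⟩
      have h1 := dist_triangle_left z y x
      have h2 : dist x y ≤ T := hx
      rw [Metric.mem_closedBall]
      linarith
    · rintro x ⟨hx, hxy⟩
      rw [add_sub_cancel]
      obtain ⟨γ, hγ, hm⟩ := exists_matches_matchRep (Γ := Γ) (P := P) (R := R) x
      set a := matchRep Γ P R x
      have ha : a ∈ D := by rwa [hDm γ a hm, hγ]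
      have hj : (γ * τ a, code a) ∈ F := ⟨a, ha, matchRep_idem x, γ, hm, rfl⟩
      have hfr := (isFrame_of_mem (ρ := ρ) (w := w) hr hF hj).of_fixes h (by
        have h1 := hdist a ha γ
        have h2 := dist_triangle_left ((γ * τ a) • (0 : E d)) y (γ • a)
        rw [Metric.mem_closedBall] at hxy
        rw [← hγ] at hxy
        simp only
        linarith)
      -- The frame pulled back by `δ` is again in `F`. Its label forces the same representative, so
      -- `δ⁻¹ * γ` matches at `a`; composing with `γ⁻¹` shows that `δ` fixes the patch of `P` at
      -- `x`.
      obtain ⟨b, hb, -, η, hη, heq⟩ := mem_of_isFrame hd hw hr hF hfr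
      simp only [Prod.mk.injEq] at heq
      have hab : a = b := hcode ha hb heq.2
      rw [← hab] at heq hη
      have hη' : δ⁻¹ * γ = η := by
        have := heq.1
        rw [← mul_assoc] at this
        exact mul_right_cancel this
      rw [← hη'] at hη
      have h1 : Matches P R δ⁻¹ (γ • a) := by
        have hη : Matches P R (δ⁻¹ * γ) (γ⁻¹ • γ • a) := by rwa [inv_smul_smul]
        have := hη.mul hm.inv
        rwa [mul_assoc, mul_inv_cancel, mul_one] at this
      have h2 := h1.inv
      rw [Matches, inv_inv, smul_inv_smul, hγ] at h2
      exact h2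

end Universal

end AbstractPattern

theorem mainTheorem3 {d m : ℕ} (hd : 0 < d) (hm : 0 < m)
    (Γ : Subgroup (Motion d)) (hclosed : IsClosed (Γ : Set (Motion d)))
    (hΓ : ContainsTranslations Γ)
    (φ : isotropy Γ →* GL (Fin m) ℂ)
    (hφ : (∃ v : Fin m → ℂ, v ≠ 0 ∧
        ∀ γ : isotropy Γ, (φ γ : Matrix (Fin m) (Fin m) ℂ) *ᵥ v = v) ∨ Finite (isotropy Γ))
    {A B : Type*} [PatternSpace (E d) A] [MulAction Γ A] [EquivariantPatternSpace Γ (E d) A]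
    [PatternSpace (E d) B] [MulAction Γ B] [EquivariantPatternSpace Γ (E d) B]
    (hA : Glueable (E d) A) (hB : Glueable (E d) B)
    (P : A) (Q : B)
    (hPD : DeloneDeriving Γ (E d) P) (hQD : DeloneDeriving Γ (E d) Q)
    (hPb : BoundedComponents (E d) P) (hQb : BoundedComponents (E d) Q) :
    MLD Γ (E d) (E d) P Q ↔
      derivableIn Γ (E d) (E d) (smoothMaps hΓ φ) P =
        derivableIn Γ (E d) (E d) (smoothMaps hΓ φ) Q := by
  have := isPretransitive_of_translations hΓ
  constructor
  · rintro ⟨hPQ, hQP⟩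
    ext f
    exact ⟨fun hf => ⟨hf.1, hQP.trans hf.2⟩, fun hf => ⟨hf.1, hPQ.trans hf.2⟩⟩
  · intro h
    have : Nonempty (Fin m) := ⟨⟨0, hm⟩⟩
    obtain ⟨w, hw⟩ := exists_ne (0 : Fin m → ℂ)
    obtain ⟨f, hf, hPf, hfP⟩ :=
      exists_smooth_mld hd hΓ ((matrixAction φ).comp (proj hΓ)) hw hA hPD hPb
    obtain ⟨g, hg, hQg, hgQ⟩ :=
      exists_smooth_mld hd hΓ ((matrixAction φ).comp (proj hΓ)) hw hB hQD hQb
    -- Equality of the function spaces exchanges the two universal functions.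
    have hPg : g ∈ derivableIn Γ (E d) (E d) (smoothMaps hΓ φ) P := by
      rw [h]; exact ⟨hg, hQg⟩
    have hQf : f ∈ derivableIn Γ (E d) (E d) (smoothMaps hΓ φ) Q := by
      rw [← h]; exact ⟨hf, hPf⟩
    exact ⟨hPg.2.trans hgQ, hQf.2.trans hfP⟩
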